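/- A configuration $\mathcal C=(\mathcal P,\mathcal L,\mathcal I)$ consists of finite sets $\mathcal P$ of points and $\mathcal L$ of lines and an incidence relation $\mathcal I\subseteq\mathcal P\times\mathcal L$ such that any two distinct lines meet in at most one point and every line contains at least three points. For an ordering of $\mathcal P$, let $G_{\mathcal C}$ be the graph on $\mathcal P$ in which two distinct points are adjacent if they lie on a common line and no point of that line lies strictly between them in the ordering. $\mathcal C$ is forest-like if $G_{\mathcal C}$ has no cycle for some ordering of $\mathcal P$. The matroid $M_{\mathcal C}$ of $\mathcal C$ has ground set $\mathcal P$; its independent sets are the sets of at most three points that are not three points on a common line. For a matroid $M$ on $\mathcal P$ and $d\ge 0$, the realization space $\Gamma_M\subseteq\mathbb C^{d\times\mathcal P}$ is the set of matrices such that, for every $I\subseteq\mathcal P$, the columns indexed by $I$ are linearly independent if and only if $I$ is independent in $M$. Let $V_M=\overline{\Gamma_M}$ be its Zariski closure, and let $V^{\mathrm{comb}}_M=\bigcup_{M'}V_{M'}$, over all matroids $M'$ on $\mathcal P$ such that every dependent set of $M$ is dependent in $M'$. Write $V^{\mathrm{comb}}_{\mathcal C}=V^{\mathrm{comb}}_{M_{\mathcal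 C}}$. For $J\subseteq\mathcal P$, let $\mathcal C_J$ be the matroid on $\mathcal P$ obtained by setting the points of $J$ to be loops: its dependent sets are the dependent sets of $M_{\mathcal C}$ and all subsets of $\mathcal P$ that meet $J$. **Theorem.** Let $\mathcal C$ be a forest-like configuration, let $d\ge\operatorname{rank}(M_{\mathcal C})$, and let $S$ be the set of points contained in at least three lines. Then $V^{\mathrm{comb}}_{\mathcal C}\subseteq\mathbb C^{d\times\mathcal P}$ has at most $2^{|S|}$ irreducible components in the Zariski topology, and each of these components is equal to $V_{\mathcal C_J}$ for some $J\subseteq S$. -/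

import Mathlib

/-- A point and line configuration: points `P`, lines `L` and an incidence relation, such that two
distinct lines meet in at most one point and every line contains at least three points. -/
structure PLConfig (P L : Type*) where
  /-- `Inc p l` : the point `p` lies on the line `l`. -/
  Inc : P → L → Prop
  meet_unique : ∀ l l' : L, l ≠ l' → ∀ p q : P, Inc p l → Inc p l' → Inc q l → Inc q l' → p = q
  three_points : ∀ l : L, ∃ p q r : P, p ≠ q ∧ p ≠ r ∧ q ≠ r ∧ Inc p l ∧ Inc q l ∧ Inc r l

namespace PLConfig

variable {P L : Type*}

/-- The set of points lying on a line. -/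
def line (C : PLConfig P L) (l : L) : Set P := {p | C.Inc p l}

/-- The set of lines passing through a point. -/
def linesThrough (C : PLConfig P L) (p : P) : Set L := {l | C.Inc p l}

/-- The set of points contained in at least three lines. -/
def multiPoints (C : PLConfig P L) : Set P := {p | 3 ≤ (C.linesThrough p).encard}

/-- The graph of a configuration with respect to an ordering of its points: two points are adjacent
if they lie on a common line and no point of that line lies strictly between them. -/
def graph (C : PLConfig P L) (_ : LinearOrder P) : SimpleGraph P where
  Adj p q := p ≠ q ∧ ∃ l, C.Inc p l ∧ C.Inc q l ∧
    ∀ r, C.Inc r l → ¬(p < r ∧ r < q) ∧ ¬(q < r ∧ r < p)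
  symm := ⟨fun _ _ ⟨h, l, hp, hq, hr⟩ => ⟨h.symm, l, hq, hp, fun r h' => (hr r h').symm⟩⟩
  loopless := ⟨fun _ h => h.1 rfl⟩

/-- A configuration is forest-like if its graph has no cycle, for some ordering of the points. -/
def IsForestLike (C : PLConfig P L) : Prop :=
  ∃ o : LinearOrder P, (C.graph o).IsAcyclic

/-- Independent sets of the matroid of a configuration: at most three points, and not three
points on a common line. -/
def IndepSet (C : PLConfig P L) (I : Set P) : Prop :=
  I.ncard ≤ 3 ∧ (I.ncard = 3 → ∀ l, ¬ I ⊆ C.line l)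

theorem indepSet_of_ncard_le_two (C : PLConfig P L) {I : Set P} (h : I.ncard ≤ 2) :
    C.IndepSet I := ⟨by omega, fun h' => by omega⟩

theorem indepSet_aug [Finite P] (C : PLConfig P L) ⦃I J : Set P⦄ (hI : C.IndepSet I)
    (hJ : C.IndepSet J) (hIJ : I.ncard < J.ncard) :
    ∃ e ∈ J, e ∉ I ∧ C.IndepSet (insert e I) := by
  obtain ⟨e, heJ, heI⟩ := Set.exists_mem_notMem_of_ncard_lt_ncard hIJ
  by_cases h1 : I.ncard ≤ 1
  · refine ⟨e, heJ, heI, C.indepSet_of_ncard_le_two ?_⟩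
    rw [Set.ncard_insert_of_notMem heI]
    omega
  have hJ3 := hJ.1
  have h2 : I.ncard = 2 := by omega
  have hJ3 : J.ncard = 3 := by omega
  by_contra! hcon
  have key : ∀ f ∈ J, f ∉ I → ∃ l, insert f I ⊆ C.line l := by
    intro f hf hfI
    by_contra! hl
    refine hcon f hf hfI ⟨?_, fun _ => hl⟩
    rw [Set.ncard_insert_of_notMem hfI]
    omega
  obtain ⟨l, hl⟩ := key e heJ heI
  obtain ⟨a, b, hab, rfl⟩ := Set.ncard_eq_two.1 h2
  refine hJ.2 hJ3 l fun f hf => ?_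
  by_cases hfI : f ∈ ({a, b} : Set P)
  · exact hl (Set.mem_insert_of_mem _ hfI)
  obtain ⟨l', hl'⟩ := key f hf hfI
  have hll : l = l' := by
    by_contra hne
    exact hab (C.meet_unique l l' hne a b (hl (by simp)) (hl' (by simp))
      (hl (by simp)) (hl' (by simp)))
  subst hll
  exact hl' (Set.mem_insert _ _)

/-- The simple matroid of rank at most three associated with a configuration: its ground set is the
set of points, and three points are dependent if and only if they lie on a common line. -/
noncomputable def matroid [Finite P] (C : PLConfig P L) : Matroid P :=
  (IndepMatroid.ofFinite (E := Set.univ) Set.finite_univ C.IndepSet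
    (C.indepSet_of_ncard_le_two (by simp))
    (fun I J hJ hIJ => ⟨(Set.ncard_le_ncard hIJ).trans hJ.1, fun h l hl => by
      have hle := Set.ncard_le_ncard hIJ
      have hJ3 := hJ.1
      have : I = J := Set.eq_of_subset_of_ncard_le hIJ (by omega)
      subst this
      exact hJ.2 h l hl⟩)
    C.indepSet_aug (fun _ _ => Set.subset_univ _)).matroid

theorem matroid_ground [Finite P] (C : PLConfig P L) : C.matroid.E = Set.univ := rfl

theorem matroid_indep_iff [Finite P] (C : PLConfig P L) (I : Set P) :
    C.matroid.Indep I ↔ I.ncard ≤ 3 ∧ (I.ncard = 3 → ∀ l, ¬ I ⊆ C.line l) := Iff.rfl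

end PLConfig

/-- The matroid obtained from `M` by setting the elements of `J` to be loops: restrict to the
complement of `J`, then put the elements of `J` back as loops. -/
def Matroid.setLoops {P : Type*} (M : Matroid P) (J : Set P) : Matroid P :=
  (M.restrict (M.E \ J)).restrict M.E

theorem Matroid.setLoops_dep_iff {P : Type*} (M : Matroid P) (J D : Set P) :
    (M.setLoops J).Dep D ↔ D ⊆ M.E ∧ (M.Dep D ∨ (J ∩ D).Nonempty) := by
  have h1 : (J ∩ D).Nonempty ↔ ¬ Disjoint D J := by
    rw [Set.not_disjoint_iff_nonempty_inter, Set.inter_comm]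
  rw [h1]
  simp only [Matroid.setLoops, Matroid.dep_iff, Matroid.restrict_indep_iff,
    Matroid.restrict_ground_eq, Set.subset_sdiff]
  tauto

/-- The affine space of complex `d × P` matrices. It is a type synonym, and carries the Zariski
topology. -/
def ZMatrix (d : ℕ) (P : Type*) : Type _ := Fin d → P → ℂ

namespace ZMatrix

variable {d : ℕ} {P : Type*}

/-- The column of a matrix at an index. -/
def col (X : ZMatrix d P) (p : P) : Fin d → ℂ := fun i => X i p

/-- The common zero set of a set of polynomials in the matrix entries. -/
def zeros (F : Set (MvPolynomial (Fin d × P) ℂ)) : Set (ZMatrix d P) :=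
  {X | ∀ f ∈ F, MvPolynomial.eval (fun ip : Fin d × P => X ip.1 ip.2) f = 0}

/-- The Zariski topology: the closed sets are the common zero sets of sets of polynomials. -/
instance : TopologicalSpace (ZMatrix d P) :=
  TopologicalSpace.ofClosed {Z | ∃ F, Z = zeros F}
    ⟨{1}, by ext X; simp [zeros]⟩
    (by
      intro A hA
      refine ⟨⋃₀ {F | zeros F ∈ A}, ?_⟩
      ext X
      constructor
      · rintro h f ⟨F, hF, hf⟩
        exact h _ hF f hf
      · intro h Z hZ
        obtain ⟨F, rfl⟩ := hA hZ
        exact fun f hf => h f ⟨F, hZ, hf⟩)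
    (by
      rintro _ ⟨F, rfl⟩ _ ⟨G, rfl⟩
      refine ⟨{h | ∃ f ∈ F, ∃ g ∈ G, h = f * g}, ?_⟩
      ext X
      constructor
      · rintro (h | h) _ ⟨f, hf, g, hg, rfl⟩
        · simp [h f hf]
        · simp [h g hg]
      · intro h
        by_contra hcon
        simp only [Set.mem_union, not_or, zeros, Set.mem_ofPred_eq, not_forall] at hcon
        obtain ⟨⟨f, hf, hf0⟩, g, hg, hg0⟩ := hcon
        have := h (f * g) ⟨f, hf, g, hg, rfl⟩
        rw [map_mul] at this
        exact (mul_ne_zero hf0 hg0) this)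

theorem isClosed_iff (Z : Set (ZMatrix d P)) : IsClosed Z ↔ ∃ F, Z = zeros F := by
  rw [← isOpen_compl_iff]
  change Zᶜᶜ ∈ {Z | ∃ F, Z = zeros F} ↔ _
  rw [compl_compl]
  rfl

end ZMatrix

namespace Matroid

variable {P : Type*}

/-- The realization space in `ℂ^d`: a collection of columns is linearly independent if and only if
its index set is independent in the matroid. -/
def realizationSpace (d : ℕ) (M : Matroid P) : Set (ZMatrix d P) :=
  {X | ∀ I : Set P, LinearIndepOn ℂ X.col I ↔ M.Indep I}

/-- The matroid variety: the Zariski closure of the realization space. -/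
def variety (d : ℕ) (M : Matroid P) : Set (ZMatrix d P) :=
  _root_.closure (M.realizationSpace d)

/-- The dependency order on matroids with the same ground set: every dependent set of the first is
dependent in the second. -/
def DepLE (M N : Matroid P) : Prop := M.E = N.E ∧ ∀ D, M.Dep D → N.Dep D

/-- The combinatorial closure: the union of the varieties of all matroids above `M` in the
dependency order. -/
def combClosure (d : ℕ) (M : Matroid P) : Set (ZMatrix d P) :=
  ⋃ N ∈ {N : Matroid P | M.DepLE N}, N.variety d

end Matroid

/-! Give each line `l` a normal vector `n l` in `ℂ³`; a point on `l` then satisfies `n l ⬝ᵥ x p =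
0`. Working in `ℂ³` loses nothing, because columns that satisfy the dependencies of `C` span at most
three dimensions. The dependencies become orthogonality relations along the edges of the point-line
incidence graph. For a forest-like configuration this graph can be built by adding vertices one at a
time, each with at most one earlier neighbour (`IsForestLike.leafEliminable_incidenceGraph`). Hence
two systems of nonzero vectors with these relations are joined by polynomial curves, vertex by
vertex: a curve orthogonal to a given `u` is `u ⨯₃ w` with `w` free (`exists_orthogonal_curves`).

Zero vectors are the obstruction. A point at zero is left out and filled in last. If it lies on at
most two lines, a curve orthogonal to their normals, multiplied by the parameter, leaves zero and
reaches the prescribed end. The normals of three lines need not stay coplanar, so a point on three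
or more lines is kept at zero: it becomes a loop. Let `X` be in the combinatorial closure and `J`
the set of points on at least three lines where `X` vanishes. Then a polynomial curve joins `X` to
any realization of `C_J`, and all but finitely many of its members realize `C_J` (`exists_curve`).

Realizations exist by a generic choice along the same elimination order
(`realizationSpace_nonempty`). So the combinatorial closure is the finite union of the `V_{C_J}`
with `J ⊆ S`. The same curves join any two realizations of `C_J`, so each `V_{C_J}` is irreducible,
and the components are among them. -/

/-! ### Leaf elimination in forests -/

namespace SimpleGraph

/-- In every nonempty finite set of vertices of the graph there is one with at most one neighbour
in that set. -/
def LeafEliminable {V : Type*} (G : SimpleGraph V) : Prop :=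
  ∀ s : Finset V, s.Nonempty → ∃ c ∈ s, ∀ u ∈ s, ∀ w ∈ s, G.Adj c u → G.Adj c w → u = w

/-- The start of a longest path works: a neighbour off the path would lengthen it, and one on the
path other than the second vertex would close a cycle. -/
theorem IsAcyclic.exists_forall_adj_eq {V : Type*} [Finite V] [Nonempty V] {G : SimpleGraph V}
    (hG : G.IsAcyclic) : ∃ c, ∀ u w, G.Adj c u → G.Adj c w → u = w := by
  obtain ⟨u, v, p, hp, hmax⟩ := Walk.exists_isPath_forall_isPath_length_le_length G
  have key : ∀ w, G.Adj u w → w = p.snd := fun w hw => by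
    refine hG.eq_snd_of_adj_start hp hw ?_
    by_contra hnot
    have := hmax _ _ _ (hp.cons (h := hw.symm) hnot)
    rw [Walk.length_cons] at this
    omega
  exact ⟨u, fun w w' hw hw' => (key w hw).trans (key w' hw').symm⟩

theorem IsAcyclic.leafEliminable {V : Type*} {G : SimpleGraph V} (hG : G.IsAcyclic) :
    G.LeafEliminable := by
  intro s hs
  have : Nonempty (s : Set V) := hs.to_subtype
  obtain ⟨c, hc⟩ := (hG.induce (s : Set V)).exists_forall_adj_eq
  exact ⟨c, c.2, fun u hu w hw hcu hcw =>
    congrArg Subtype.val (hc ⟨u, hu⟩ ⟨w, hw⟩ hcu hcw)⟩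

theorem LeafEliminable.induction {V : Type*} {G : SimpleGraph V} (hG : G.LeafEliminable)
    {motive : Finset V → Prop} (empty : motive ∅)
    (cons : ∀ (s : Finset V) (c : V) (h : c ∉ s),
      (∀ u ∈ s, ∀ w ∈ s, G.Adj c u → G.Adj c w → u = w) → motive s → motive (s.cons c h))
    (s : Finset V) : motive s := by
  classical
  induction hn : s.card generalizing s with
  | zero => rwa [Finset.card_eq_zero.1 hn]
  | succ n ih =>
    obtain ⟨c, hc, hu⟩ := hG s (Finset.card_pos.1 (by omega))
    have h := cons (s.erase c) c (Finset.notMem_erase c s)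
      (fun u hus w hws => hu u (Finset.mem_of_mem_erase hus) w (Finset.mem_of_mem_erase hws))
      (ih _ (by rw [Finset.card_erase_of_mem hc]; omega))
    rwa [Finset.cons_eq_insert, Finset.insert_erase hc] at h

end SimpleGraph

/-! ### The incidence graph of a forest-like configuration -/

namespace PLConfig

variable {P L : Type*}

/-- The bipartite graph on points and lines given by the incidence relation. -/
def incidenceGraph (C : PLConfig P L) : SimpleGraph (P ⊕ L) where
  Adj u w := (∃ p l, u = .inl p ∧ w = .inr l ∧ C.Inc p l) ∨
    ∃ p l, w = .inl p ∧ u = .inr l ∧ C.Inc p l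
  symm := ⟨fun _ _ h => h.symm⟩
  loopless := ⟨by rintro _ (⟨p, l, rfl, h, _⟩ | ⟨p, l, rfl, h, _⟩) <;> cases h⟩

@[simp] theorem incidenceGraph_inl_inr (C : PLConfig P L) (p : P) (l : L) :
    C.incidenceGraph.Adj (.inl p) (.inr l) ↔ C.Inc p l := by
  simp [incidenceGraph]

@[simp] theorem incidenceGraph_inr_inl (C : PLConfig P L) (p : P) (l : L) :
    C.incidenceGraph.Adj (.inr l) (.inl p) ↔ C.Inc p l := by
  simp [incidenceGraph]

@[simp] theorem incidenceGraph_inl_inl (C : PLConfig P L) (p q : P) :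
    ¬ C.incidenceGraph.Adj (.inl p) (.inl q) := by
  simp [incidenceGraph]

@[simp] theorem incidenceGraph_inr_inr (C : PLConfig P L) (l k : L) :
    ¬ C.incidenceGraph.Adj (.inr l) (.inr k) := by
  simp [incidenceGraph]

theorem exists_graph_adj_of_lt [Finite P] (C : PLConfig P L) (o : LinearOrder P) {l : L} {u q : P}
    (hu : C.Inc u l) (hq : C.Inc q l) (huq : u < q) :
    ∃ v, C.Inc v l ∧ u < v ∧ v ≤ q ∧ (C.graph o).Adj u v := by
  obtain ⟨v, ⟨hvl, huv⟩, hmin⟩ := Set.exists_min_image {v | C.Inc v l ∧ u < v} id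
    (Set.toFinite _) ⟨q, hq, huq⟩
  refine ⟨v, hvl, huv, hmin q ⟨hq, huq⟩, huv.ne, l, hu, hvl, fun r hr => ⟨fun h => ?_, fun h => ?_⟩⟩
  · exact absurd (hmin r ⟨hr, h.1⟩) (not_le.2 h.2)
  · exact absurd (h.1.trans h.2) (not_lt.2 huv.le)

theorem exists_graph_adj_of_gt [Finite P] (C : PLConfig P L) (o : LinearOrder P) {l : L} {u q : P}
    (hu : C.Inc u l) (hq : C.Inc q l) (huq : q < u) :
    ∃ v, C.Inc v l ∧ v < u ∧ q ≤ v ∧ (C.graph o).Adj u v := by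
  obtain ⟨v, ⟨hvl, huv⟩, hmax⟩ := Set.exists_max_image {v | C.Inc v l ∧ v < u} id
    (Set.toFinite _) ⟨q, hq, huq⟩
  refine ⟨v, hvl, huv, hmax q ⟨hq, huq⟩, huv.ne', l, hu, hvl, fun r hr => ⟨fun h => ?_, fun h => ?_⟩⟩
  · exact absurd (h.1.trans h.2) (not_lt.2 huv.le)
  · exact absurd (hmax r ⟨hr, h.2⟩) (not_le.2 h.1)

/-- A set `s` in which every vertex has two neighbours would yield a set `U` of points in which
every point has two neighbours in `C.graph o`. This is impossible in a forest. -/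
theorem IsForestLike.leafEliminable_incidenceGraph [Finite P] {C : PLConfig P L}
    (hC : C.IsForestLike) : C.incidenceGraph.LeafEliminable := by
  classical
  obtain ⟨o, ho⟩ := hC
  intro s hs
  by_contra! hcon
  have hline : ∀ l, Sum.inr l ∈ s → ∀ u, ∃ q, Sum.inl q ∈ s ∧ C.Inc q l ∧ q ≠ u := by
    intro l hl u
    obtain ⟨a, ha, b, hb, hla, hlb, hab⟩ := hcon _ hl
    rcases a with a | a <;> rcases b with b | b <;> simp at hla hlb
    by_cases h : a = u
    · exact ⟨b, hb, hlb, fun h' => hab (by rw [h, h'])⟩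
    · exact ⟨a, ha, hla, h⟩
  have hpoint : ∀ p, Sum.inl p ∈ s → ∃ l k, Sum.inr l ∈ s ∧ Sum.inr k ∈ s ∧ l ≠ k ∧
      C.Inc p l ∧ C.Inc p k := by
    intro p hp
    obtain ⟨a, ha, b, hb, hla, hlb, hab⟩ := hcon _ hp
    rcases a with a | a <;> rcases b with b | b <;> simp at hla hlb
    exact ⟨a, b, ha, hb, fun h => hab (by rw [h]), hla, hlb⟩
  have : Fintype P := Fintype.ofFinite P
  -- the points lying on a line of `s` between two points of `s` on that line
  let U : Finset P := Finset.univ.filter fun u => ∃ l, Sum.inr l ∈ s ∧ C.Inc u l ∧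
    ∃ q q', Sum.inl q ∈ s ∧ Sum.inl q' ∈ s ∧ C.Inc q l ∧ C.Inc q' l ∧ q ≤ u ∧ u ≤ q'
  have hU : ∀ u, u ∈ U ↔ ∃ l, Sum.inr l ∈ s ∧ C.Inc u l ∧
    ∃ q q', Sum.inl q ∈ s ∧ Sum.inl q' ∈ s ∧ C.Inc q l ∧ C.Inc q' l ∧ q ≤ u ∧ u ≤ q' := by
    simp [U]
  -- On `l`, move from `u` to the next point in the direction of another point of `s`.
  have hnbr : ∀ u l, Sum.inl u ∈ s → Sum.inr l ∈ s → C.Inc u l →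
      ∃ v ∈ U, C.Inc v l ∧ (C.graph o).Adj u v := by
    intro u l hu hl hul
    obtain ⟨q, hq, hql, hqu⟩ := hline l hl u
    rcases lt_or_gt_of_ne hqu with h | h
    · obtain ⟨v, hv, h1, h2, h3⟩ := C.exists_graph_adj_of_gt o hul hql h
      exact ⟨v, (hU v).2 ⟨l, hl, hv, q, u, hq, hu, hql, hul, h2, h1.le⟩, hv, h3⟩
    · obtain ⟨v, hv, h1, h2, h3⟩ := C.exists_graph_adj_of_lt o hul hql h
      exact ⟨v, (hU v).2 ⟨l, hl, hv, u, q, hu, hq, hul, hql, h1.le, h2⟩, hv, h3⟩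
  have hUne : U.Nonempty := by
    have key : ∀ p, Sum.inl p ∈ s → U.Nonempty := fun p hp => by
      obtain ⟨l, -, hl, -, -, hpl, -⟩ := hpoint p hp
      obtain ⟨v, hv, -⟩ := hnbr p l hp hl hpl
      exact ⟨v, hv⟩
    obtain ⟨p | l, hc⟩ := hs
    · exact key p hc
    · obtain ⟨a, ha, -⟩ := hcon _ hc
      obtain ⟨q, hq, -⟩ : ∃ q, Sum.inl q ∈ s ∧ True := by
        rcases a with a | a
        · exact ⟨a, ha, trivial⟩
        · obtain ⟨b, hb, c, hc', h, -⟩ := hcon _ ha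
          rcases b with b | b
          · exact ⟨b, hb, trivial⟩
          · simp at h
      exact key q hq
  obtain ⟨u, hu, hleaf⟩ := ho.leafEliminable U hUne
  -- A point of `s` has neighbours along two different lines, distinct because the lines meet only
  -- in `u`. A point outside `s` lies strictly between two points of `s` on a line, so it has a
  -- neighbour on either side.
  by_cases hus : Sum.inl u ∈ s
  · obtain ⟨l, k, hl, hk, hlk, hul, huk⟩ := hpoint u hus
    obtain ⟨v, hv, hvl, huv⟩ := hnbr u l hus hl hul
    obtain ⟨w, hw, hwk, huw⟩ := hnbr u k hus hk huk
    have := hleaf v hv w hw huv huw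
    subst this
    exact huv.ne (C.meet_unique l k hlk u v hul huk hvl hwk)
  · obtain ⟨l, hl, hul, q, q', hq, hq', hql, hql', h1, h2⟩ := (hU u).1 hu
    have h1' : q < u := lt_of_le_of_ne h1 (by rintro rfl; exact hus hq)
    have h2' : u < q' := lt_of_le_of_ne h2 (by rintro rfl; exact hus hq')
    obtain ⟨v, hvl, hvu, hqv, huv⟩ := C.exists_graph_adj_of_gt o hul hql h1'
    obtain ⟨w, hwl, huw, hwq, huw'⟩ := C.exists_graph_adj_of_lt o hul hql' h2'
    have := hleaf v ((hU v).2 ⟨l, hl, hvl, q, q', hq, hq', hql, hql', hqv, hvu.le.trans h2⟩)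
      w ((hU w).2 ⟨l, hl, hwl, q, q', hq, hq', hql, hql', h1.trans huw.le, hwq⟩) huv huw'
    subst this
    exact lt_asymm hvu huw

end PLConfig

/-! ### Polynomial curves of orthogonal vectors in three-space -/

section CrossProduct

open Matrix Polynomial

theorem Matrix.exists_dotProduct_eq_one {K n : Type*} [Field K] [Fintype n] {u : n → K}
    (hu : u ≠ 0) : ∃ g : n → K, u ⬝ᵥ g = 1 := by
  classical
  obtain ⟨i, hi⟩ := Function.ne_iff.1 hu
  exact ⟨Pi.single i (u i)⁻¹, by simpa using mul_inv_cancel₀ hi⟩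

/-- With `u ⬝ᵥ g = 1`, the expansion of `u ⨯₃ (a ⨯₃ g)` is `(u ⬝ᵥ g) • a - (u ⬝ᵥ a) • g = a`. -/
theorem exists_crossProduct_eq {K : Type*} [Field K] {u a : Fin 3 → K} (hu : u ≠ 0)
    (hua : u ⬝ᵥ a = 0) : ∃ w, u ⨯₃ w = a := by
  obtain ⟨g, hg⟩ := exists_dotProduct_eq_one hu
  exact ⟨a ⨯₃ g, by rw [cross_cross_eq_smul_sub_smul', hg, dotProduct_comm a u, hua]; simp⟩

theorem exists_eq_smul_crossProduct {K : Type*} [Field K] {u w b : Fin 3 → K}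
    (h : LinearIndependent K ![u, w]) (hu : u ⬝ᵥ b = 0) (hw : w ⬝ᵥ b = 0) :
    ∃ σ : K, b = σ • u ⨯₃ w := by
  have hne := crossProduct_ne_zero_iff_linearIndependent.2 h
  have h0 : (u ⨯₃ w) ⨯₃ b = 0 := by
    rw [cross_cross_eq_smul_sub_smul, hu, hw]; simp
  by_contra! hcon
  refine crossProduct_ne_zero_iff_linearIndependent.2 ?_ h0
  rw [LinearIndependent.pair_iff' hne]
  exact fun a ha => hcon a ha.symm

/-- Evaluation of a vector of polynomials. -/
def evalVec {n : Type*} (t : ℂ) (v : n → ℂ[X]) : n → ℂ := fun i => (v i).eval t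

theorem evalVec_crossProduct (t : ℂ) (u w : Fin 3 → ℂ[X]) :
    evalVec t (u ⨯₃ w) = evalVec t u ⨯₃ evalVec t w := by
  ext i
  fin_cases i <;> simp [evalVec, cross_apply]

theorem evalVec_dotProduct {n : Type*} [Fintype n] (t : ℂ) (u w : n → ℂ[X]) :
    (u ⬝ᵥ w).eval t = evalVec t u ⬝ᵥ evalVec t w := by
  simp [evalVec, dotProduct, eval_finsetSum]

/-- The straight line that is at `a` for `t = 0` and at `b` for `t = 1`. -/
noncomputable def lineVec {n : Type*} (a b : n → ℂ) : n → ℂ[X] := fun i => C (a i) + X * C (b i - a i)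

@[simp] theorem evalVec_zero_lineVec {n : Type*} (a b : n → ℂ) : evalVec 0 (lineVec a b) = a := by
  ext i; simp [evalVec, lineVec]

@[simp] theorem evalVec_one_lineVec {n : Type*} (a b : n → ℂ) : evalVec 1 (lineVec a b) = b := by
  ext i; simp [evalVec, lineVec]

/-- Both ends are cross products with `u`; interpolating the second factor linearly preserves
orthogonality identically in the parameter. -/
theorem exists_orthogonal_curve {u : Fin 3 → ℂ[X]} {a b : Fin 3 → ℂ} (h0 : evalVec 0 u ≠ 0)
    (h1 : evalVec 1 u ≠ 0) (ha : evalVec 0 u ⬝ᵥ a = 0) (hb : evalVec 1 u ⬝ᵥ b = 0) :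
    ∃ v : Fin 3 → ℂ[X], evalVec 0 v = a ∧ evalVec 1 v = b ∧ u ⬝ᵥ v = 0 := by
  obtain ⟨w0, rfl⟩ := exists_crossProduct_eq h0 ha
  obtain ⟨w1, rfl⟩ := exists_crossProduct_eq h1 hb
  exact ⟨u ⨯₃ lineVec w0 w1, by simp [evalVec_crossProduct], by simp [evalVec_crossProduct],
    dot_self_cross _ _⟩

/-- Each new vertex is constrained by at most one curve already built. The vectors must be nonzero
because that curve needs a direction at both ends. -/
theorem SimpleGraph.LeafEliminable.exists_orthogonal_curves {V : Type*} {G : SimpleGraph V}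
    (hG : G.LeafEliminable) (s : Finset V) {a b : V → Fin 3 → ℂ}
    (ha : ∀ u ∈ s, a u ≠ 0) (hb : ∀ u ∈ s, b u ≠ 0)
    (haa : ∀ u ∈ s, ∀ w ∈ s, G.Adj u w → a u ⬝ᵥ a w = 0)
    (hbb : ∀ u ∈ s, ∀ w ∈ s, G.Adj u w → b u ⬝ᵥ b w = 0) :
    ∃ v : V → Fin 3 → ℂ[X], (∀ u ∈ s, evalVec 0 (v u) = a u) ∧ (∀ u ∈ s, evalVec 1 (v u) = b u) ∧
      ∀ u ∈ s, ∀ w ∈ s, G.Adj u w → v u ⬝ᵥ v w = 0 := by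
  classical
  revert ha hb haa hbb
  induction s using hG.induction with
  | empty => intros; exact ⟨0, by simp⟩
  | cons s c hc hu ih =>
    simp only [Finset.forall_mem_cons]
    rintro ⟨hac, ha⟩ ⟨hbc, hb⟩ ⟨haac, haa⟩ ⟨hbbc, hbb⟩
    obtain ⟨v, hv0, hv1, hvv⟩ := ih ha hb (fun u hu => (haa u hu).2) (fun u hu => (hbb u hu).2)
    obtain ⟨z, hz0, hz1, hz⟩ : ∃ z : Fin 3 → ℂ[X], evalVec 0 z = a c ∧ evalVec 1 z = b c ∧
        ∀ u ∈ s, G.Adj c u → v u ⬝ᵥ z = 0 := by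
      by_cases hex : ∃ u ∈ s, G.Adj c u
      · obtain ⟨u, hus, hcu⟩ := hex
        obtain ⟨z, h0, h1, h⟩ := exists_orthogonal_curve (u := v u) (a := a c) (b := b c)
          (by rw [hv0 u hus]; exact ha u hus) (by rw [hv1 u hus]; exact hb u hus)
          (by rw [hv0 u hus]; exact (haa u hus).1 hcu.symm)
          (by rw [hv1 u hus]; exact (hbb u hus).1 hcu.symm)
        exact ⟨z, h0, h1, fun w hw hcw => hu u hus w hw hcu hcw ▸ h⟩
      · push Not at hex
        exact ⟨lineVec (a c) (b c), by simp, by simp, fun u hu h => absurd h (hex u hu)⟩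
    have hne : ∀ u ∈ s, u ≠ c := fun u hu h => hc (h ▸ hu)
    refine ⟨Function.update v c z, ⟨by simpa, fun u hu => ?_⟩, ⟨by simpa, fun u hu => ?_⟩,
      ⟨by simp, fun u hu h => ?_⟩, fun u hu => ⟨fun h => ?_, fun w hw h => ?_⟩⟩
    · rw [Function.update_of_ne (hne u hu), hv0 u hu]
    · rw [Function.update_of_ne (hne u hu), hv1 u hu]
    · rw [Function.update_of_ne (hne u hu), Function.update_self, dotProduct_comm]
      exact hz u hu h
    · rw [Function.update_of_ne (hne u hu), Function.update_self]
      exact hz u hu h.symm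
    · rw [Function.update_of_ne (hne u hu), Function.update_of_ne (hne w hw)]
      exact hvv u hu w hw h

/-- Let `k` be a set with at most two elements that indexes curves `v i`, independent at `t = 1`.
A vector orthogonal to all `v i` at `t = 1` is the end of a curve that starts at zero and remains
orthogonal to all `v i`. -/
theorem exists_orthogonal_curve_from_zero {ι : Type*} (k : Set ι) (hk : k.encard < 3)
    (v : ι → Fin 3 → ℂ[X]) {b : Fin 3 → ℂ} (hne : ∀ i ∈ k, evalVec 1 (v i) ≠ 0)
    (hind : ∀ i ∈ k, ∀ j ∈ k, i ≠ j → LinearIndependent ℂ ![evalVec 1 (v i), evalVec 1 (v j)])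
    (hb : ∀ i ∈ k, evalVec 1 (v i) ⬝ᵥ b = 0) :
    ∃ z : Fin 3 → ℂ[X], evalVec 0 z = 0 ∧ evalVec 1 z = b ∧ ∀ i ∈ k, v i ⬝ᵥ z = 0 := by
  -- Multiplication by the parameter makes the curve vanish at `0`, and changes neither its value at
  -- `1` nor the orthogonality.
  suffices h : ∃ z : Fin 3 → ℂ[X], evalVec 1 z = b ∧ ∀ i ∈ k, v i ⬝ᵥ z = 0 by
    obtain ⟨z, hz1, hz⟩ := h
    refine ⟨(X : ℂ[X]) • z, ?_, ?_, fun i hi => by rw [dotProduct_smul, hz i hi, smul_zero]⟩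
    · ext i; simp [evalVec]
    · ext i; simp [← hz1, evalVec]
  rcases k.eq_empty_or_nonempty with rfl | ⟨i, hi⟩
  · exact ⟨lineVec 0 b, by simp, by simp⟩
  by_cases hall : ∃ j ∈ k, i ≠ j
  · obtain ⟨j, hj, hij⟩ := hall
    have hkij : k = {i, j} := by
      have hk2 : k.encard ≤ 2 := ENat.lt_add_one_iff (by simp) |>.1 (by rwa [two_add_one_eq_three])
      have hfin : k.Finite := Set.finite_of_encard_le_coe (k := 2) hk2
      refine (hfin.eq_of_subset_of_encard_le' ?_ ?_).symm
      · rintro x (rfl | rfl) <;> assumption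
      · rwa [Set.encard_pair hij]
    -- At `t = 1` the common orthogonal complement is the line spanned by the cross product. At `t =
    -- 0` the two curves may be parallel, which does no harm.
    obtain ⟨σ, hσ⟩ := exists_eq_smul_crossProduct (hind i hi j hj hij) (hb i hi) (hb j hj)
    refine ⟨C σ • v i ⨯₃ v j, ?_, ?_⟩
    · rw [hσ, ← evalVec_crossProduct]
      ext m; simp [evalVec]
    · rw [hkij]
      rintro x (rfl | rfl)
      · rw [dotProduct_smul, dot_self_cross, smul_zero]
      · rw [dotProduct_smul, dot_cross_self, smul_zero]
  · push Not at hall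
    obtain ⟨w, hw⟩ := exists_crossProduct_eq (hne i hi) (hb i hi)
    refine ⟨v i ⨯₃ lineVec w w, by rw [evalVec_crossProduct]; simpa, fun j hj => ?_⟩
    rw [← hall j hj, dot_self_cross]

end CrossProduct

/-! ### Polynomial families of matrices and Zariski-open conditions -/

namespace ZMatrix

open Polynomial Filter

variable {d : ℕ} {P : Type*}

/-- The member at `t` of a family of matrices that depends polynomially on a parameter. -/
noncomputable def evalMat (t : ℂ) (γ : Fin d → P → ℂ[X]) : ZMatrix d P := fun i p => (γ i p).eval t

theorem exists_eval_ne_zero_of_isOpen {U : Set (ZMatrix d P)} (hU : IsOpen U) {X : ZMatrix d P}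
    (hX : X ∈ U) : ∃ f : MvPolynomial (Fin d × P) ℂ,
      MvPolynomial.eval (fun ip : Fin d × P => X ip.1 ip.2) f ≠ 0 ∧
      ∀ Y : ZMatrix d P, MvPolynomial.eval (fun ip : Fin d × P => Y ip.1 ip.2) f ≠ 0 → Y ∈ U := by
  obtain ⟨F, hF⟩ := (isClosed_iff _).1 hU.isClosed_compl
  have h : X ∉ zeros F := by rw [← hF]; simpa
  simp only [zeros, Set.mem_ofPred_eq, not_forall] at h
  obtain ⟨f, hf, hne⟩ := h
  refine ⟨f, hne, fun Y hY => ?_⟩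
  by_contra hYU
  have : Y ∈ zeros F := by rw [← hF]; exact hYU
  exact hY (this f hf)

theorem isOpen_setOf_eval_ne_zero (f : MvPolynomial (Fin d × P) ℂ) :
    IsOpen {X : ZMatrix d P | MvPolynomial.eval (fun ip : Fin d × P => X ip.1 ip.2) f ≠ 0} := by
  rw [← isClosed_compl_iff, isClosed_iff]
  exact ⟨{f}, by ext X; simp [zeros]⟩

/-- A polynomial that is nonzero at `t₀` and whose nonvanishing implies membership in `U` pulls back
to a nonzero polynomial in one variable, which has finitely many roots. -/
theorem eventually_evalMat_mem (γ : Fin d → P → ℂ[X]) {U : Set (ZMatrix d P)} (hU : IsOpen U)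
    {t₀ : ℂ} (h : evalMat t₀ γ ∈ U) : ∀ᶠ t in cofinite, evalMat t γ ∈ U := by
  obtain ⟨f, hne, hf⟩ := exists_eval_ne_zero_of_isOpen hU h
  let q : ℂ[X] := MvPolynomial.aeval (fun ip : Fin d × P => γ ip.1 ip.2) f
  have hq : ∀ t, q.eval t = MvPolynomial.eval (fun ip : Fin d × P => evalMat t γ ip.1 ip.2) f := by
    intro t
    have := DFunLike.congr_fun (MvPolynomial.comp_aeval (R := ℂ)
      (fun ip : Fin d × P => γ ip.1 ip.2) (Polynomial.aeval t)) f
    simpa [q, evalMat, MvPolynomial.aeval_eq_eval, Polynomial.coe_aeval_eq_eval] using this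
  have hq0 : q ≠ 0 := by
    rintro h0
    rw [← hq, h0] at hne
    simp at hne
  refine (q.rootSet_finite ℂ).subset fun t ht => ?_
  rw [Polynomial.mem_rootSet]
  refine ⟨hq0, ?_⟩
  by_contra h'
  refine ht (hf _ ?_)
  rw [← hq]
  simpa [Polynomial.coe_aeval_eq_eval] using h'

theorem isOpen_setOf_linearIndepOn [Finite P] (I : Set P) :
    IsOpen {X : ZMatrix d P | LinearIndepOn ℂ X.col I} := by
  classical
  have : Fintype I := Fintype.ofFinite I
  rw [isOpen_iff_forall_mem_open]
  intro X hX
  -- A left inverse `g`, fixed at `X`, replaces the choice of a nonzero minor: the determinant of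
  -- `g` applied to the columns in `I` is polynomial in the matrix and equals `1` at `X`.
  obtain ⟨g, hg⟩ := LinearMap.exists_leftInverse_of_injective
    (Fintype.linearCombination ℂ (fun i : I => X.col i))
    (LinearMap.ker_eq_bot.2 (hX.fintypeLinearCombination_injective))
  let N : Matrix I I (MvPolynomial (Fin d × P) ℂ) := Matrix.of fun i j =>
    ∑ k, MvPolynomial.X (k, j.1) * MvPolynomial.C (g (Pi.single k 1) i)
  have hN : ∀ Y : ZMatrix d P, MvPolynomial.eval (fun ip : Fin d × P => Y ip.1 ip.2) N.det =
      Matrix.det (Matrix.of fun i j : I => g (Y.col j) i) := by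
    intro Y
    rw [RingHom.map_det]
    congr 1
    ext i j
    rw [Matrix.of_apply, LinearMap.pi_apply_eq_sum_univ g (Y.col j)]
    simp only [RingHom.mapMatrix_apply, Matrix.map_apply, Matrix.of_apply, N, map_sum, map_mul, MvPolynomial.eval_X,
      MvPolynomial.eval_C, Finset.sum_apply, Pi.smul_apply, smul_eq_mul, col]
    refine Finset.sum_congr rfl fun k _ => ?_
    have hk : (Pi.single k 1 : Fin d → ℂ) = fun m => if k = m then 1 else 0 := by
      ext m
      simp [Pi.single_apply, eq_comm]
    rw [hk]
  refine ⟨_, fun Y hY => ?_, isOpen_setOf_eval_ne_zero N.det, ?_⟩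
  · rw [Set.mem_ofPred_eq, hN] at hY
    have := Matrix.linearIndependent_cols_of_det_ne_zero hY
    exact LinearIndependent.of_comp g this
  · rw [Set.mem_ofPred_eq, hN]
    have : (Matrix.of fun i j : I => g (X.col j) i) = (1 : Matrix I I ℂ) := by
      ext i j
      have := congrFun (LinearMap.congr_fun hg (Pi.single j 1)) i
      simpa [Fintype.linearCombination_apply_single, Matrix.one_apply, Pi.single_apply] using this
    rw [this]
    simp

theorem eventually_linearIndepOn [Finite P] (γ : Fin d → P → ℂ[X]) (I : Set P) {t₀ : ℂ}
    (h : LinearIndepOn ℂ (evalMat t₀ γ).col I) :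
    ∀ᶠ t in cofinite, LinearIndepOn ℂ (evalMat t γ).col I :=
  eventually_evalMat_mem γ (isOpen_setOf_linearIndepOn I) h

end ZMatrix

/-! ### Linear algebra of spans, hyperplanes and finite unions of subspaces -/

/-- If all sets of `k + 1` indices in `S` are dependent, then the span of `S` has dimension at
most `k`. -/
theorem finrank_span_le_of_forall_not_linearIndepOn {ι K V : Type*} [Field K] [AddCommGroup V]
    [Module K V] [Finite ι] {v : ι → V} {S : Set ι} {k : ℕ}
    (h : ∀ I ⊆ S, I.ncard = k + 1 → ¬ LinearIndepOn K v I) :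
    Module.finrank K (Submodule.span K (v '' S)) ≤ k := by
  obtain ⟨b, hbS, -, hspan, hb⟩ :=
    exists_linearIndepOn_extension (linearIndepOn_empty K v) (Set.empty_subset S)
  have hle : Submodule.span K (v '' S) = Submodule.span K (v '' b) :=
    le_antisymm (Submodule.span_le.2 hspan) (Submodule.span_mono (Set.image_mono hbS))
  have hbk : b.ncard ≤ k := by
    by_contra! hlt
    obtain ⟨I, hI, hIk⟩ := Set.exists_subset_card_eq (show k + 1 ≤ b.ncard by omega)
    exact h I (hI.trans hbS) hIk (hb.mono hI)
  rw [hle]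
  refine le_trans ?_ hbk
  have : Fintype b := Fintype.ofFinite b
  rw [Set.image_eq_range]
  refine (finrank_range_le_card _).trans ?_
  rw [← Nat.card_eq_fintype_card, Nat.card_coe_set_eq]

/-- Serves to move vectors between `ℂ^d` and `ℂ³`, in either direction, without changing which sets
of them are independent. -/
theorem exists_factor_through_of_finrank_span_le {ι K V : Type*} [Field K] [AddCommGroup V]
    [Module K V] [FiniteDimensional K V] {v : ι → V} {k : ℕ}
    (h : Module.finrank K (Submodule.span K (Set.range v)) ≤ k) :
    ∃ (f : V →ₗ[K] (Fin k → K)) (g : (Fin k → K) →ₗ[K] V), ∀ i, g (f (v i)) = v i := by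
  let W := Submodule.span K (Set.range v)
  obtain ⟨j, hj⟩ : ∃ j : W →ₗ[K] (Fin k → K), Function.Injective j := by
    let e := LinearEquiv.ofFinrankEq W (Fin (Module.finrank K W) → K) (by rw [Module.finrank_fin_fun])
    refine ⟨(Function.ExtendByZero.linearMap K (Fin.castLE h)) ∘ₗ e.toLinearMap, ?_⟩
    refine Function.Injective.comp (g := Function.ExtendByZero.linearMap K (Fin.castLE h))
      (fun a b hab => funext fun i => ?_) e.injective
    have := congrFun hab (Fin.castLE h i)
    simpa [Function.ExtendByZero.linearMap_apply,
      (Fin.castLE_injective h).extend_apply] using this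
  obtain ⟨f, hf⟩ := LinearMap.exists_extend j
  obtain ⟨r, hr⟩ := LinearMap.exists_leftInverse_of_injective j (LinearMap.ker_eq_bot.2 hj)
  refine ⟨f, W.subtype ∘ₗ r, fun i => ?_⟩
  have hi : v i ∈ W := Submodule.subset_span ⟨i, rfl⟩
  have h1 : f (v i) = j ⟨v i, hi⟩ := by rw [← hf]; rfl
  have h2 : r (j ⟨v i, hi⟩) = ⟨v i, hi⟩ := LinearMap.congr_fun hr _
  simp [h1, h2]

open Matrix in
theorem exists_eq_smul_of_forall_dotProduct {K n : Type*} [Field K] [Fintype n]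
    {a e : n → K} (h : ∀ z, a ⬝ᵥ z = 0 → e ⬝ᵥ z = 0) : ∃ σ : K, e = σ • a := by
  by_cases ha : a = 0
  · subst ha
    exact ⟨0, by rw [zero_smul]; exact dotProduct_eq_zero _ fun w => h w (zero_dotProduct w)⟩
  · obtain ⟨g, hg⟩ := exists_dotProduct_eq_one ha
    refine ⟨e ⬝ᵥ g, sub_eq_zero.1 (dotProduct_eq_zero _ fun w => ?_)⟩
    have := h (w - (a ⬝ᵥ w) • g) (by simp [dotProduct_sub, hg])
    rw [dotProduct_sub, dotProduct_smul] at this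
    rw [sub_dotProduct, smul_dotProduct, ← this]
    simp [mul_comm]

open Matrix in
-- The space orthogonal to `a` has dimension at least two, so it is not inside the line of `u`.
-- Otherwise every `u ⨯₃ g` would be a multiple of `a`; expanding `(u ⨯₃ g) ⨯₃ (u ⨯₃ g') = 0` then
-- makes every `u ⨯₃ g'` vanish, and so `u` as well.
theorem exists_dotProduct_eq_zero_crossProduct_ne_zero {K : Type*} [Field K] (a : Fin 3 → K)
    {u : Fin 3 → K} (hu : u ≠ 0) : ∃ z, a ⬝ᵥ z = 0 ∧ u ⨯₃ z ≠ 0 := by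
  by_contra! hcon
  have h1 : ∀ g, ∃ σ : K, u ⨯₃ g = σ • a := fun g =>
    exists_eq_smul_of_forall_dotProduct fun z hz => by
      rw [dotProduct_comm, triple_product_permutation, triple_product_permutation,
        ← cross_anticomm, hcon z hz]
      simp
  have h2 : ∀ g g', u ⨯₃ g' ⬝ᵥ g = 0 := by
    intro g g'
    obtain ⟨σ, hσ⟩ := h1 g
    obtain ⟨τ, hτ⟩ := h1 g'
    have h := cross_cross_eq_smul_sub_smul u g (u ⨯₃ g')
    have h0 : (u ⨯₃ g) ⨯₃ (u ⨯₃ g') = 0 := by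
      rw [hσ, hτ]
      simp
    rw [h0, dot_self_cross, zero_smul, zero_sub, eq_comm, neg_eq_zero, smul_eq_zero,
      or_iff_left hu, dotProduct_comm] at h
    exact h
  have h3 : ∀ g, u ⨯₃ g = 0 := fun g => dotProduct_eq_zero _ fun w => h2 w g
  have h4 := h3 ![1, 0, 0]
  have h5 := h3 ![0, 1, 0]
  refine hu (funext fun i => ?_)
  simp only [cross_apply, cons_eq_zero_iff] at h4 h5
  fin_cases i
  · simpa using h5.2.2.1
  · simpa using h4.2.2.1
  · simpa using h4.2.1

theorem Submodule.exists_mem_forall_notMem {K V : Type*} [DivisionRing K] [Infinite K]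
    [AddCommGroup V] [Module K V] (W : Submodule K V) {T : Set (Submodule K V)} (hT : T.Finite)
    (h : ∀ U ∈ T, ¬ W ≤ U) : ∃ z ∈ W, ∀ U ∈ T, z ∉ U := by
  classical
  have hne := Subspace.biUnion_ne_univ_of_top_notMem (k := K) (E := W)
    (s := (hT.image (Submodule.comap W.subtype)).toFinset) (by
      rw [Set.Finite.mem_toFinset]
      rintro ⟨U, hU, hU'⟩
      exact h U hU (Submodule.comap_subtype_eq_top.1 hU'))
  obtain ⟨z, hz⟩ := (Set.ne_univ_iff_exists_notMem _).1 hne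
  simp only [Set.mem_iUnion, not_exists, Set.Finite.mem_toFinset] at hz
  exact ⟨z, z.2, fun U hU hzU => hz _ ⟨U, hU, rfl⟩ hzU⟩

/-! ### Generic systems of orthogonal vectors -/

namespace SimpleGraph

open Matrix

/-- Vectors at the vertices `s` of a graph that are orthogonal exactly along edges and satisfy no
linear dependency that is not forced by the orthogonality. -/
structure IsGenericOn {V : Type*} (G : SimpleGraph V) (v : V → Fin 3 → ℂ) (s : Finset V) :
    Prop where
  ne_zero : ∀ u ∈ s, v u ≠ 0
  cross_ne_zero : ∀ u ∈ s, ∀ w ∈ s, u ≠ w → v u ⨯₃ v w ≠ 0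
  dot_eq_zero_iff : ∀ u ∈ s, ∀ w ∈ s, u ≠ w → (v u ⬝ᵥ v w = 0 ↔ G.Adj u w)
  triple_ne_zero : ∀ u ∈ s, ∀ w ∈ s, ∀ z ∈ s, u ≠ w → u ≠ z → w ≠ z → ¬ G.Adj u w →
    ¬ G.Adj u z → ¬ G.Adj w z → (∀ b, G.Adj b u → G.Adj b w → ¬ G.Adj b z) →
    v u ⬝ᵥ v w ⨯₃ v z ≠ 0

theorem IsGenericOn.congr {V : Type*} {G : SimpleGraph V} {v v' : V → Fin 3 → ℂ} {s : Finset V}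
    (h : G.IsGenericOn v s) (hv : ∀ u ∈ s, v' u = v u) : G.IsGenericOn v' s where
  ne_zero u hu := by rw [hv u hu]; exact h.ne_zero u hu
  cross_ne_zero u hu w hw := by rw [hv u hu, hv w hw]; exact h.cross_ne_zero u hu w hw
  dot_eq_zero_iff u hu w hw := by rw [hv u hu, hv w hw]; exact h.dot_eq_zero_iff u hu w hw
  triple_ne_zero u hu w hw z hz := by
    rw [hv u hu, hv w hw, hv z hz]; exact h.triple_ne_zero u hu w hw z hz

/-- The new vector is chosen in the space orthogonal to its only earlier neighbour, or in the whole
space if there is none, off finitely many subspaces. Over an infinite field this is possible once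
none of them contains that space. -/
theorem IsGenericOn.exists_extension {V : Type*} [Finite V] {G : SimpleGraph V}
    {v : V → Fin 3 → ℂ} {s : Finset V} (h : G.IsGenericOn v s) (c : V)
    (hc : ∀ u ∈ s, ∀ w ∈ s, G.Adj c u → G.Adj c w → u = w) :
    ∃ z : Fin 3 → ℂ, z ≠ 0 ∧ (∀ u ∈ s, v u ⨯₃ z ≠ 0) ∧
      (∀ u ∈ s, v u ⬝ᵥ z = 0 ↔ G.Adj c u) ∧
      ∀ u ∈ s, ∀ w ∈ s, u ≠ w → ¬ G.Adj u w → ¬ G.Adj c u → ¬ G.Adj c w →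
        (∀ b, G.Adj b u → G.Adj b w → ¬ G.Adj b c) → v u ⨯₃ v w ⬝ᵥ z ≠ 0 := by
  obtain ⟨a, ha⟩ : ∃ a : Fin 3 → ℂ, (a = 0 ∧ ∀ u ∈ s, ¬ G.Adj c u) ∨
      ∃ b ∈ s, G.Adj c b ∧ a = v b := by
    by_cases hex : ∃ b ∈ s, G.Adj c b
    · obtain ⟨b, hb, hcb⟩ := hex
      exact ⟨v b, .inr ⟨b, hb, hcb, rfl⟩⟩
    · push Not at hex
      exact ⟨0, .inl ⟨rfl, hex⟩⟩
  let K : (Fin 3 → ℂ) → Submodule ℂ (Fin 3 → ℂ) := fun e => LinearMap.ker (dotProductBilin ℂ ℂ e)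
  have hK : ∀ e z, z ∈ K e ↔ e ⬝ᵥ z = 0 := fun e z => Iff.rfl
  have hle : ∀ e, K a ≤ K e → ∃ σ : ℂ, e = σ • a := fun e he =>
    exists_eq_smul_of_forall_dotProduct fun z hz => he hz
  let T : Set (Submodule ℂ (Fin 3 → ℂ)) := {⊥} ∪
    (fun u => LinearMap.ker (crossProduct (v u))) '' {u | u ∈ s} ∪
    (fun u => K (v u)) '' {u | u ∈ s ∧ ¬ G.Adj c u} ∪
    (fun uw : V × V => K (v uw.1 ⨯₃ v uw.2)) '' {uw | uw.1 ∈ s ∧ uw.2 ∈ s ∧ uw.1 ≠ uw.2 ∧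
      ¬ G.Adj uw.1 uw.2 ∧ ¬ G.Adj c uw.1 ∧ ¬ G.Adj c uw.2 ∧
      ∀ b, G.Adj b uw.1 → G.Adj b uw.2 → ¬ G.Adj b c}
  have hT : T.Finite := (((Set.finite_singleton _).union ((Set.toFinite _).image _)).union
    ((Set.toFinite _).image _)).union ((Set.toFinite _).image _)
  obtain ⟨z, hza, hz⟩ := (K a).exists_mem_forall_notMem hT (by
    rintro U (((rfl | ⟨u, hu, rfl⟩) | ⟨u, ⟨hu, hcu⟩, rfl⟩) |
      ⟨⟨u, w⟩, ⟨hu, hw, huw, hauw, hcu, hcw, hb⟩, rfl⟩) hKU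
    · obtain ⟨z, hz, hne⟩ := exists_dotProduct_eq_zero_crossProduct_ne_zero a
        (one_ne_zero : (1 : Fin 3 → ℂ) ≠ 0)
      have := (Submodule.mem_bot ℂ).1 (hKU ((hK a z).2 hz))
      simp [this] at hne
    · obtain ⟨z, hz, hne⟩ := exists_dotProduct_eq_zero_crossProduct_ne_zero a (h.ne_zero u hu)
      exact hne (hKU ((hK a z).2 hz))
    · obtain ⟨σ, hσ⟩ := hle _ hKU
      rcases ha with ⟨rfl, -⟩ | ⟨b, hbs, hcb, rfl⟩
      · exact h.ne_zero u hu (by simpa using hσ)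
      · refine h.cross_ne_zero b hbs u hu (by rintro rfl; exact hcu hcb) ?_
        rw [hσ, map_smul, cross_self, smul_zero]
    -- If the choice fails, `v u ⨯₃ v w` is a nonzero multiple of `v b`. Then `b` is orthogonal,
    -- hence adjacent, to `u` and `w`, and so is a common neighbour of `u`, `w` and `c`. Since `c`
    -- is adjacent to neither `u` nor `w`, `b` differs from both.
    · obtain ⟨σ, hσ⟩ := hle _ hKU
      dsimp only at hu hw huw hauw hcu hcw hb hσ
      have hne := h.cross_ne_zero u hu w hw huw
      rcases ha with ⟨rfl, -⟩ | ⟨b, hbs, hcb, rfl⟩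
      · exact hne (by simpa using hσ)
      · have hσ0 : σ ≠ 0 := by
          rintro rfl
          exact hne (by simpa using hσ)
        have hbu : b ≠ u := by rintro rfl; exact hcu hcb
        have hbw : b ≠ w := by rintro rfl; exact hcw hcb
        refine hb b ((h.dot_eq_zero_iff b hbs u hu hbu).1 ?_)
          ((h.dot_eq_zero_iff b hbs w hw hbw).1 ?_) hcb.symm
        · have h0 := dot_self_cross (v u) (v w)
          rw [hσ, dotProduct_smul, smul_eq_mul, mul_eq_zero, or_iff_right hσ0] at h0
          rwa [dotProduct_comm]
        · have h0 := dot_cross_self (v u) (v w)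
          rw [hσ, dotProduct_smul, smul_eq_mul, mul_eq_zero, or_iff_right hσ0] at h0
          rwa [dotProduct_comm])
  refine ⟨z, fun h0 => hz ⊥ (.inl (.inl (.inl rfl))) (by simp [h0]),
    fun u hu h0 => hz _ (.inl (.inl (.inr ⟨u, hu, rfl⟩))) h0, fun u hu => ⟨fun h0 => ?_, fun hcu => ?_⟩,
    fun u hu w hw huw h1 h2 h3 h4 h0 => hz _ (.inr ⟨(u, w), ⟨hu, hw, huw, h1, h2, h3, h4⟩, rfl⟩) h0⟩
  · by_contra hcu
    exact hz _ (.inl (.inr ⟨u, ⟨hu, hcu⟩, rfl⟩)) h0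
  · rcases ha with ⟨-, hno⟩ | ⟨b, hbs, hcb, rfl⟩
    · exact absurd hcu (hno u hu)
    · rw [hc u hu b hbs hcu hcb]
      exact hza

theorem LeafEliminable.exists_isGenericOn {V : Type*} [Finite V] {G : SimpleGraph V}
    (hG : G.LeafEliminable) (s : Finset V) : ∃ v, G.IsGenericOn v s := by
  classical
  induction s using hG.induction with
  | empty => exact ⟨0, by simp, by simp, by simp, by simp⟩
  | cons s c hcs hc ih =>
    obtain ⟨v₀, h₀⟩ := ih
    obtain ⟨z, hz, hcross, hdot, htriple⟩ := h₀.exists_extension c hc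
    have hne : ∀ u ∈ s, u ≠ c := fun u hu h => hcs (h ▸ hu)
    have hv : ∀ u ∈ s, Function.update v₀ c z u = v₀ u := fun u hu =>
      Function.update_of_ne (hne u hu) _ _
    have hvc : Function.update v₀ c z c = z := Function.update_self _ _ _
    have hs := h₀.congr hv
    refine ⟨Function.update v₀ c z, ?_, ?_, ?_, ?_⟩
    · simp only [Finset.forall_mem_cons, hvc]
      exact ⟨hz, hs.ne_zero⟩
    · simp only [Finset.forall_mem_cons, hvc]
      refine ⟨⟨by simp, fun u hu _ h => ?_⟩, fun u hu => ⟨fun _ => ?_, hs.cross_ne_zero u hu⟩⟩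
      · rw [hv u hu, ← cross_anticomm, neg_eq_zero] at h
        exact hcross u hu h
      · rw [hv u hu]
        exact hcross u hu
    · simp only [Finset.forall_mem_cons, hvc]
      refine ⟨⟨by simp, fun u hu _ => ?_⟩, fun u hu => ⟨fun _ => ?_, hs.dot_eq_zero_iff u hu⟩⟩
      · rw [hv u hu, dotProduct_comm]
        exact hdot u hu
      · rw [hv u hu, hdot u hu, G.adj_comm]
    · simp only [Finset.forall_mem_cons, hvc]
      refine ⟨⟨by simp, fun w hw => ⟨by simp, fun y hy h1 h2 h3 h4 h5 h6 h7 => ?_⟩⟩,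
        fun u hu => ⟨⟨by simp, fun y hy h1 h2 h3 h4 h5 h6 h7 => ?_⟩,
          fun w hw => ⟨fun h1 h2 h3 h4 h5 h6 h7 => ?_, hs.triple_ne_zero u hu w hw⟩⟩⟩
      · rw [hv w hw, hv y hy, dotProduct_comm]
        exact htriple w hw y hy h3 h6 h4 h5 fun b hbw hby hbc => h7 b hbc hbw hby
      · rw [hv u hu, hv y hy, triple_product_permutation, dotProduct_comm]
        exact htriple y hy u hu h2.symm (mt Adj.symm h5) h6 (mt Adj.symm h4)
          fun b hby hbu hbc => h7 b hbu hbc hby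
      · rw [hv u hu, hv w hw, ← triple_product_permutation, dotProduct_comm]
        exact htriple u hu w hw h1 h4 (mt Adj.symm h5) (mt Adj.symm h6) h7

end SimpleGraph

/-! ### Auxiliary facts on independence and irreducibility -/

open Filter in
theorem eventually_evalVec_ne_zero {n : Type*} {u : n → Polynomial ℂ} {t₀ : ℂ}
    (h : evalVec t₀ u ≠ 0) : ∀ᶠ t in cofinite, evalVec t u ≠ 0 := by
  obtain ⟨i, hi⟩ := Function.ne_iff.1 h
  have h0 : u i ≠ 0 := by
    intro h0
    simp [evalVec, h0] at hi
  refine ((u i).rootSet_finite ℂ).subset fun t ht => ?_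
  have ht' : evalVec t u = 0 := not_not.1 ht
  rw [Polynomial.mem_rootSet]
  exact ⟨h0, by simpa [evalVec, Polynomial.coe_aeval_eq_eval] using congrFun ht' i⟩

theorem LinearIndepOn.ncard_le_finrank {ι K V : Type*} [Field K] [AddCommGroup V] [Module K V]
    [FiniteDimensional K V] [Finite ι] {v : ι → V} {I : Set ι} (h : LinearIndepOn K v I) :
    I.ncard ≤ Module.finrank K V := by
  have : Fintype I := Fintype.ofFinite I
  rw [← Nat.card_coe_set_eq, Nat.card_eq_fintype_card]
  exact LinearIndependent.fintype_card_le_finrank h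

theorem LinearIndepOn.of_map_eq {ι K V W : Type*} [Field K] [AddCommGroup V] [Module K V]
    [AddCommGroup W] [Module K W] {v : ι → V} {w : ι → W} {I : Set ι} (h : LinearIndepOn K w I)
    (g : V →ₗ[K] W) (hg : ∀ i, g (v i) = w i) : LinearIndepOn K v I := by
  obtain rfl : (fun i => g (v i)) = w := funext hg
  exact LinearIndependent.of_comp g h

open Matrix in
theorem eq_zero_of_dotProduct_eq_zero_of_linearIndepOn {ι K : Type*} [Field K] [Finite ι] {m : ℕ}
    {v : ι → Fin m → K} {I : Set ι} (h : LinearIndepOn K v I) (hI : I.ncard = m) {n : Fin m → K}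
    (hn : ∀ i ∈ I, n ⬝ᵥ v i = 0) : n = 0 := by
  have : Fintype I := Fintype.ofFinite I
  have hspan := LinearIndependent.span_eq_top_of_card_eq_finrank' (b := fun i : I => v i) h
    (by rw [← Nat.card_eq_fintype_card, Nat.card_coe_set_eq, hI, Module.finrank_fin_fun])
  have hle : (⊤ : Submodule K (Fin m → K)) ≤ LinearMap.ker (dotProductBilin K K n) := by
    rw [← hspan, Submodule.span_le]
    rintro _ ⟨i, rfl⟩
    exact hn i i.2
  exact dotProduct_eq_zero _ fun w => hle (Submodule.mem_top : w ∈ ⊤)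

theorem Topology.IsInducing.isPreirreducible_of_image {X Y : Type*} [TopologicalSpace X]
    [TopologicalSpace Y] {f : X → Y} (hf : Topology.IsInducing f) {s : Set X}
    (hs : IsPreirreducible (f '' s)) : IsPreirreducible s := by
  rintro U V hU hV ⟨x, hx, hxU⟩ ⟨y, hy, hyV⟩
  obtain ⟨U, hU', rfl⟩ := hf.isOpen_iff.1 hU
  obtain ⟨V, hV', rfl⟩ := hf.isOpen_iff.1 hV
  obtain ⟨_, ⟨z, hz, rfl⟩, hzUV⟩ :=
    hs U V hU' hV' ⟨f x, ⟨x, hx, rfl⟩, hxU⟩ ⟨f y, ⟨y, hy, rfl⟩, hyV⟩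
  exact ⟨z, hz, hzUV⟩

/-! ### Loops and the combinatorial closure -/

namespace Matroid

theorem setLoops_indep_iff {P : Type*} (M : Matroid P) (hM : M.E = Set.univ) (J I : Set P) :
    (M.setLoops J).Indep I ↔ M.Indep I ∧ Disjoint I J := by
  simp only [setLoops, restrict_indep_iff, hM, Set.subset_sdiff, Set.subset_univ, true_and,
    and_true]

theorem depLE_setLoops {P : Type*} (M : Matroid P) (J : Set P) : M.DepLE (M.setLoops J) :=
  ⟨rfl, fun D hD => (M.setLoops_dep_iff J D).2 ⟨hD.subset_ground, .inl hD⟩⟩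

/-- Independence of columns is an open condition, so it passes from a point of the closure to an
honest realization of some `N` above `M`. This is all that is used about members of the
combinatorial closure. -/
theorem indep_of_mem_combClosure {P : Type*} [Finite P] {M : Matroid P} (hM : M.E = Set.univ)
    {d : ℕ} {X : ZMatrix d P} (hX : X ∈ M.combClosure d) {I : Set P}
    (hI : LinearIndepOn ℂ X.col I) : M.Indep I := by
  simp only [combClosure, Set.mem_iUnion] at hX
  obtain ⟨N, hN, hXN⟩ := hX
  obtain ⟨Y, hYI, hY⟩ := mem_closure_iff.1 hXN _ (ZMatrix.isOpen_setOf_linearIndepOn I) hI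
  by_contra hdep
  exact (hN.2 I ((not_indep_iff (by rw [hM]; exact Set.subset_univ _)).1 hdep)).not_indep
    ((hY I).1 hYI)

end Matroid

/-! ### Deformation and existence of realizations -/

namespace PLConfig

open Matrix Polynomial Filter

variable {P L : Type*} [Finite P]

theorem matroid_setLoops_indep_iff (C : PLConfig P L) (J I : Set P) :
    (C.matroid.setLoops J).Indep I ↔ C.matroid.Indep I ∧ Disjoint I J :=
  C.matroid.setLoops_indep_iff C.matroid_ground J I

/-- No three vectors on the line are independent, so they span a proper subspace of `ℂ³`. The normal
is not unique when they span less than a plane; any choice will do. -/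
theorem exists_normal (C : PLConfig P L) {v : P → Fin 3 → ℂ}
    (hv : ∀ I, LinearIndepOn ℂ v I → C.matroid.Indep I) (l : L) :
    ∃ n : Fin 3 → ℂ, n ≠ 0 ∧ ∀ p, C.Inc p l → n ⬝ᵥ v p = 0 := by
  have hrank := finrank_span_le_of_forall_not_linearIndepOn (K := ℂ) (v := v) (S := C.line l)
    (k := 2) fun I hI hcard hind => ((C.matroid_indep_iff I).1 (hv I hind)).2 hcard l hI
  obtain ⟨f, hf, hle⟩ := Submodule.exists_le_ker_of_lt_top (Submodule.span ℂ (v '' C.line l))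
    (lt_top_iff_ne_top.2 fun h => by
      rw [h, finrank_top, Module.finrank_fin_fun] at hrank
      omega)
  have hfn : ∀ z, (fun i => f (Pi.single i 1)) ⬝ᵥ z = f z := fun z => by
    conv_rhs => rw [pi_eq_sum_univ' z]
    simp [dotProduct, mul_comm]
  refine ⟨fun i => f (Pi.single i 1), fun h => hf ?_, fun p hp => ?_⟩
  · ext z
    rw [LinearMap.comp_apply, ← hfn, h]
    simp
  · rw [hfn]
    exact hle (Submodule.subset_span ⟨p, hp, rfl⟩)

theorem indepSet_of_two_lines (C : PLConfig P L) {l k : L} (hlk : l ≠ k) {p q r : P}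
    (hpl : C.Inc p l) (hpk : C.Inc p k) (hql : C.Inc q l) (hrk : C.Inc r k) (hqp : q ≠ p)
    (hrp : r ≠ p) : ({p, q, r} : Set P).ncard = 3 ∧ C.matroid.Indep {p, q, r} := by
  have hqr : q ≠ r := by
    rintro rfl
    exact hqp (C.meet_unique l k hlk q p hql hrk hpl hpk)
  have hcard : ({p, q, r} : Set P).ncard = 3 :=
    Set.ncard_eq_three.2 ⟨p, q, r, hqp.symm, hrp.symm, hqr, rfl⟩
  refine ⟨hcard, (C.matroid_indep_iff _).2 ⟨hcard.le, fun _ j hj => ?_⟩⟩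
  have hp : C.Inc p j := hj (by simp)
  have hq : C.Inc q j := hj (by simp)
  have hr : C.Inc r j := hj (by simp)
  have hjl : j = l := by
    by_contra h
    exact hqp (C.meet_unique j l h q p hq hql hp hpl)
  have hjk : j = k := by
    by_contra h
    exact hrp (C.meet_unique j k h r p hr hrk hp hpk)
  exact hlk (hjl.symm.trans hjk)

/-- Vectors in `ℂ³` that satisfy all dependencies of `C`, and vanish on `J` and possibly at points
on at most two lines, can be deformed into any realization of `C` with loops `J`, through vectors
satisfying all its dependencies. -/
theorem exists_curve_vectors [Finite L] (C : PLConfig P L)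
    (hC : C.incidenceGraph.LeafEliminable) {J : Set P} {x y : P → Fin 3 → ℂ}
    (hx : ∀ I, LinearIndepOn ℂ x I → C.matroid.Indep I) (hxJ : ∀ p ∈ J, x p = 0)
    (hxS : ∀ p ∉ J, x p = 0 → (C.linesThrough p).encard < 3)
    (hy : ∀ I, LinearIndepOn ℂ y I ↔ (C.matroid.setLoops J).Indep I) :
    ∃ w : P → Fin 3 → ℂ[X], (∀ p, evalVec 0 (w p) = x p) ∧ (∀ p, evalVec 1 (w p) = y p) ∧
      ∀ᶠ t in cofinite, ∀ I, LinearIndepOn ℂ (fun p => evalVec t (w p)) I →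
        (C.matroid.setLoops J).Indep I := by
  classical
  have hy' : ∀ I, LinearIndepOn ℂ y I → C.matroid.Indep I := fun I hI =>
    ((C.matroid_setLoops_indep_iff J I).1 ((hy I).1 hI)).1
  choose n hn hnx using C.exists_normal hx
  choose m hm hmy using C.exists_normal hy'
  have hyJ : ∀ p ∈ J, y p = 0 := by
    intro p hp
    by_contra h
    have := ((C.matroid_setLoops_indep_iff J {p}).1 ((hy {p}).1 (LinearIndepOn.singleton h))).2
    exact Set.disjoint_left.1 this rfl hp
  have hyne : ∀ p ∉ J, y p ≠ 0 := by
    intro p hp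
    rw [← linearIndepOn_singleton_iff ℂ, hy, C.matroid_setLoops_indep_iff]
    exact ⟨C.indepSet_of_ncard_le_two (by simp), Set.disjoint_singleton_left.2 hp⟩
  -- the lines that carry at least two points outside `J`
  let act : Set L := {l | ∀ p, ∃ q ∉ J, C.Inc q l ∧ q ≠ p}
  -- Beside `p`, each of the two lines has a point outside `J`, and `y` is independent at these
  -- three points. If `m k` were a multiple of `m l`, it would be orthogonal to all three.
  have hmm : ∀ l ∈ act, ∀ k ∈ act, l ≠ k → ∀ p ∉ J, C.Inc p l → C.Inc p k →
      LinearIndependent ℂ ![m l, m k] := by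
    intro l hl k hk hlk p hp hpl hpk
    obtain ⟨q, hq, hql, hqp⟩ := hl p
    obtain ⟨r, hr, hrk, hrp⟩ := hk p
    obtain ⟨hcard, hind⟩ := C.indepSet_of_two_lines hlk hpl hpk hql hrk hqp hrp
    have hdisj : Disjoint ({p, q, r} : Set P) J := by
      rw [Set.disjoint_left]
      rintro _ (rfl | rfl | rfl) <;> assumption
    have hyI := (hy _).2 ((C.matroid_setLoops_indep_iff _ _).2 ⟨hind, hdisj⟩)
    rw [LinearIndependent.pair_iff' (hm l)]
    intro a ha
    refine hm k (eq_zero_of_dotProduct_eq_zero_of_linearIndepOn hyI hcard ?_)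
    rintro _ (rfl | rfl | rfl)
    · exact hmy k _ hpk
    · rw [← ha, smul_dotProduct, hmy l _ hql, smul_zero]
    · exact hmy k _ hrk
  have := Fintype.ofFinite P
  have := Fintype.ofFinite L
  -- Points where `x` vanishes are left out because `exists_orthogonal_curves` needs nonzero
  -- vectors. Lines that are not active impose no condition, since no three of their points avoid
  -- `J`.
  let s : Finset (P ⊕ L) := Finset.univ.filter
    (Sum.elim (fun p => p ∉ J ∧ x p ≠ 0) (fun l => l ∈ act))
  have hsP : ∀ p, Sum.inl p ∈ s ↔ p ∉ J ∧ x p ≠ 0 := fun p => by simp [s]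
  have hsL : ∀ l, Sum.inr l ∈ s ↔ l ∈ act := fun l => by simp [s]
  obtain ⟨v, hv0, hv1, hvv⟩ := hC.exists_orthogonal_curves s (a := Sum.elim x n)
    (b := Sum.elim y m)
    (by
      rintro (p | l) h
      · exact ((hsP p).1 h).2
      · exact hn l)
    (by
      rintro (p | l) h
      · exact hyne p ((hsP p).1 h).1
      · exact hm l)
    (by
      rintro (p | l) - (q | k) - h <;> simp at h
      · rw [dotProduct_comm]; exact hnx k p h
      · exact hnx l q h)
    (by
      rintro (p | l) - (q | k) - h <;> simp at h
      · rw [dotProduct_comm]; exact hmy k p h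
      · exact hmy l q h)
  have hvm : ∀ l ∈ act, evalVec 1 (v (.inr l)) = m l := fun l hl => hv1 _ ((hsL l).2 hl)
  have hz : ∀ p, ∃ z : Fin 3 → ℂ[X], evalVec 0 z = x p ∧ evalVec 1 z = y p ∧
      (∀ l ∈ act, C.Inc p l → v (.inr l) ⬝ᵥ z = 0) ∧ (p ∈ J → z = 0) := by
    intro p
    by_cases hpJ : p ∈ J
    · exact ⟨0, by rw [hxJ p hpJ]; ext; simp [evalVec], by rw [hyJ p hpJ]; ext; simp [evalVec],
        by simp, fun _ => rfl⟩
    by_cases hxp : x p = 0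
    · obtain ⟨z, h0, h1, h⟩ := exists_orthogonal_curve_from_zero {l | l ∈ act ∧ C.Inc p l}
        ((Set.encard_le_encard fun l hl => hl.2).trans_lt (hxS p hpJ hxp))
        (fun l => v (.inr l)) (b := y p)
        (fun l hl => by rw [hvm l hl.1]; exact hm l)
        (fun l hl k hk hlk => by
          rw [hvm l hl.1, hvm k hk.1]
          exact hmm l hl.1 k hk.1 hlk p hpJ hl.2 hk.2)
        (fun l hl => by rw [hvm l hl.1]; exact hmy l p hl.2)
      exact ⟨z, by rw [h0, hxp], h1, fun l hl hpl => h l ⟨hl, hpl⟩, fun h => absurd h hpJ⟩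
    · have hps := (hsP p).2 ⟨hpJ, hxp⟩
      exact ⟨v (.inl p), hv0 _ hps, hv1 _ hps,
        fun l hl hpl => hvv _ ((hsL l).2 hl) _ hps (by simpa), fun h => absurd h hpJ⟩
  choose w hw0 hw1 hwv hwJ using hz
  refine ⟨w, hw0, hw1, ?_⟩
  have hev : ∀ᶠ t in cofinite, ∀ l : act, evalVec t (v (.inr l)) ≠ 0 :=
    eventually_all.2 fun l => eventually_evalVec_ne_zero (t₀ := 0) (by
      rw [hv0 _ ((hsL l).2 l.2)]
      exact hn l)
  -- As long as the normals are nonzero, three independent vectors cannot lie on one line of `C`: a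
  -- line containing them would be active, and its normal orthogonal to a basis.
  filter_upwards [hev] with t ht I hI
  have hdisj : Disjoint I J := by
    rw [Set.disjoint_left]
    intro p hpI hpJ
    refine hI.ne_zero hpI ?_
    rw [hwJ p hpJ]
    ext
    simp [evalVec]
  refine (C.matroid_setLoops_indep_iff J I).2 ⟨(C.matroid_indep_iff I).2
    ⟨hI.ncard_le_finrank.trans_eq (Module.finrank_fin_fun ℂ), fun hcard l hl => ?_⟩, hdisj⟩
  have hact : l ∈ act := by
    intro p
    obtain ⟨q, hq, hqp⟩ := Set.exists_ne_of_one_lt_ncard (s := I) (by omega) p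
    exact ⟨q, Set.disjoint_left.1 hdisj hq, hl hq, hqp⟩
  refine ht ⟨l, hact⟩ (eq_zero_of_dotProduct_eq_zero_of_linearIndepOn hI hcard fun p hp => ?_)
  rw [← evalVec_dotProduct, hwv p l hact (hl hp)]
  simp

/-- A matrix in the combinatorial closure that vanishes on `J` and otherwise only at points on at
most two lines can be deformed into any realization of `C` with loops `J`, through such
realizations. -/
theorem exists_curve [Finite L] (C : PLConfig P L) (hC : C.incidenceGraph.LeafEliminable)
    {J : Set P} {d : ℕ} {X Y : ZMatrix d P}
    (hX : ∀ I, LinearIndepOn ℂ X.col I → C.matroid.Indep I) (hXJ : ∀ p ∈ J, X.col p = 0)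
    (hXS : ∀ p ∉ J, X.col p = 0 → (C.linesThrough p).encard < 3)
    (hY : Y ∈ (C.matroid.setLoops J).realizationSpace d) :
    ∃ γ : Fin d → P → ℂ[X], ZMatrix.evalMat 0 γ = X ∧ ZMatrix.evalMat 1 γ = Y ∧
      ∀ᶠ t in cofinite, ZMatrix.evalMat t γ ∈ (C.matroid.setLoops J).realizationSpace d := by
  have hYM : ∀ I, LinearIndepOn ℂ Y.col I → C.matroid.Indep I := fun I hI =>
    ((C.matroid_setLoops_indep_iff J I).1 ((hY I).1 hI)).1
  have hfac : ∀ Z : ZMatrix d P, (∀ I, LinearIndepOn ℂ Z.col I → C.matroid.Indep I) →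
      ∃ (f : (Fin d → ℂ) →ₗ[ℂ] (Fin 3 → ℂ)) (g : (Fin 3 → ℂ) →ₗ[ℂ] (Fin d → ℂ)),
        ∀ p, g (f (Z.col p)) = Z.col p := fun Z hZ =>
    exists_factor_through_of_finrank_span_le (by
      rw [← Set.image_univ]
      refine finrank_span_le_of_forall_not_linearIndepOn fun I _ hI hind => ?_
      have := ((C.matroid_indep_iff I).1 (hZ I hind)).1
      omega)
  obtain ⟨f, g, hfg⟩ := hfac X hX
  obtain ⟨f', g', hfg'⟩ := hfac Y hYM
  obtain ⟨w, hw0, hw1, hw⟩ := C.exists_curve_vectors hC (J := J) (x := fun p => f (X.col p))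
    (y := fun p => f' (Y.col p)) (fun I hI => hX I (LinearIndependent.of_comp f hI))
    (fun p hp => by rw [hXJ p hp, map_zero])
    (fun p hp h => hXS p hp (by rw [← hfg, h, map_zero]))
    (fun I => by
      rw [← hY I]
      exact ⟨fun h => LinearIndependent.of_comp f' h, fun h => h.of_map_eq g' hfg'⟩)
  -- The embeddings `g` and `g'` of `ℂ³` for the two ends differ in general, so the embedding is
  -- interpolated linearly along with the vectors.
  let γ : Fin d → P → ℂ[X] := fun i p =>
    ∑ j, lineVec (fun j => g (Pi.single j 1) i) (fun j => g' (Pi.single j 1) i) j * w p j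
  have hγ : ∀ t p, (ZMatrix.evalMat t γ).col p = (g + t • (g' - g)) (evalVec t (w p)) := by
    intro t p
    ext i
    rw [LinearMap.pi_apply_eq_sum_univ (g + t • (g' - g))]
    have hsingle : ∀ j : Fin 3, (fun k => if j = k then (1 : ℂ) else 0) = Pi.single j 1 := by
      intro j
      ext k
      simp [Pi.single_apply, eq_comm]
    simp only [hsingle, ZMatrix.col, ZMatrix.evalMat, γ, eval_finsetSum, lineVec, eval_mul, eval_add,
      eval_C, eval_X, Finset.sum_apply, Pi.smul_apply, LinearMap.add_apply, LinearMap.smul_apply,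
      LinearMap.sub_apply, Pi.add_apply, Pi.sub_apply, smul_eq_mul, evalVec]
    exact Finset.sum_congr rfl fun j _ => by ring
  have hγ1 : ZMatrix.evalMat 1 γ = Y := by
    refine funext fun i => funext fun p => ?_
    have := congrFun (hγ 1 p) i
    rw [hw1, one_smul, add_sub_cancel, hfg'] at this
    exact this
  refine ⟨γ, ?_, hγ1, ?_⟩
  · refine funext fun i => funext fun p => ?_
    have := congrFun (hγ 0 p) i
    rw [hw0, zero_smul, add_zero, hfg] at this
    exact this
  -- The curve of vectors only controls the dependencies. That independent sets stay independent
  -- follows from the end `Y`, by openness.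
  have hopen : ∀ᶠ t in cofinite, ∀ I : Set P, (C.matroid.setLoops J).Indep I →
      LinearIndepOn ℂ (ZMatrix.evalMat t γ).col I := by
    rw [eventually_all]
    intro I
    by_cases hI : (C.matroid.setLoops J).Indep I
    · filter_upwards [ZMatrix.eventually_linearIndepOn γ I (t₀ := 1)
        (by rw [hγ1]; exact (hY I).2 hI)] with t ht _ using ht
    · exact Eventually.of_forall fun t h => absurd h hI
  filter_upwards [hw, hopen] with t ht ht' I
  exact ⟨fun hI => ht I (hI.of_map_eq _ fun p => (hγ t p).symm), ht' I⟩

/-- Generic vectors on the whole incidence graph do it: points are pairwise nonadjacent, and a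
common neighbour of three points is a line through them. -/
theorem exists_linearIndepOn_iff_indep [Finite L] (C : PLConfig P L)
    (hC : C.incidenceGraph.LeafEliminable) :
    ∃ v : P → Fin 3 → ℂ, ∀ I, LinearIndepOn ℂ v I ↔ C.matroid.Indep I := by
  classical
  have := Fintype.ofFinite P
  have := Fintype.ofFinite L
  obtain ⟨v, hv⟩ := hC.exists_isGenericOn Finset.univ
  refine ⟨fun p => v (.inl p), fun I => ?_⟩
  rw [C.matroid_indep_iff]
  constructor
  · intro hI
    refine ⟨hI.ncard_le_finrank.trans_eq (Module.finrank_fin_fun ℂ), fun hcard l hl => ?_⟩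
    refine hv.ne_zero (.inr l) (Finset.mem_univ _)
      (eq_zero_of_dotProduct_eq_zero_of_linearIndepOn hI hcard fun p hp => ?_)
    rw [hv.dot_eq_zero_iff _ (Finset.mem_univ _) _ (Finset.mem_univ _) (by simp)]
    exact (C.incidenceGraph_inr_inl p l).2 (hl hp)
  · rintro ⟨hle, hline⟩
    obtain h | h | h | h : I.ncard = 0 ∨ I.ncard = 1 ∨ I.ncard = 2 ∨ I.ncard = 3 := by omega
    · rw [Set.ncard_eq_zero] at h
      subst h
      exact linearIndepOn_empty _ _
    · obtain ⟨p, rfl⟩ := Set.ncard_eq_one.1 h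
      exact LinearIndepOn.singleton (hv.ne_zero _ (Finset.mem_univ _))
    · obtain ⟨p, q, hpq, rfl⟩ := Set.ncard_eq_two.1 h
      have hli := crossProduct_ne_zero_iff_linearIndependent.1
        (hv.cross_ne_zero (.inl p) (Finset.mem_univ _) (.inl q) (Finset.mem_univ _) (by simpa))
      rw [LinearIndepOn.pair_iff _ hpq]
      exact LinearIndependent.pair_iff.1 hli
    · obtain ⟨p, q, r, hpq, hpr, hqr, rfl⟩ := Set.ncard_eq_three.1 h
      have h0 := hv.triple_ne_zero (.inl p) (Finset.mem_univ _) (.inl q) (Finset.mem_univ _)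
        (.inl r) (Finset.mem_univ _) (by simpa) (by simpa) (by simpa) (by simp) (by simp) (by simp)
        (by
          rintro (b | l) h1 h2 h3 <;> simp at h1 h2 h3
          refine hline h l ?_
          rintro _ (rfl | rfl | rfl) <;> assumption)
      rw [triple_product_eq_det] at h0
      have hli := linearIndependent_rows_of_det_ne_zero h0
      have hinj : Function.Injective ![p, q, r] := by
        intro i j
        fin_cases i <;> fin_cases j <;> simp [hpq, hpr, hqr, hpq.symm, hpr.symm, hqr.symm]
      have hrange : ({p, q, r} : Set P) = Set.range ![p, q, r] := by
        ext i
        simp only [Set.mem_insert_iff, Set.mem_singleton_iff, Matrix.range_cons,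
          Matrix.range_empty, Set.union_empty, Set.mem_union]
      rw [hrange, linearIndepOn_range_iff hinj]
      have hcomp : (fun p => v (.inl p)) ∘ ![p, q, r] = ![v (.inl p), v (.inl q), v (.inl r)] := by
        ext i : 1
        fin_cases i <;> rfl
      rw [hcomp]
      exact hli

theorem realizationSpace_nonempty [Finite L] (C : PLConfig P L)
    (hC : C.incidenceGraph.LeafEliminable) (J : Set P) {d : ℕ}
    (hd : C.matroid.eRank ≤ (d : ℕ∞)) :
    ((C.matroid.setLoops J).realizationSpace d).Nonempty := by
  classical
  obtain ⟨v, hv⟩ := C.exists_linearIndepOn_iff_indep hC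
  -- The realization in `ℂ³` spans a space of dimension at most the rank, so it also fits into `ℂ^d`
  -- when `d < 3`.
  obtain ⟨f, g, hfg⟩ := exists_factor_through_of_finrank_span_le (K := ℂ) (v := v) (k := d) (by
    rw [← Set.image_univ]
    refine finrank_span_le_of_forall_not_linearIndepOn fun I _ hI hind => ?_
    have h := ((hv I).1 hind).encard_le_eRank.trans hd
    rw [← Set.Finite.cast_ncard_eq (Set.toFinite I), hI, Nat.cast_le] at h
    omega)
  let Y : ZMatrix d P := fun i p => if p ∈ J then 0 else f (v p) i
  refine ⟨Y, fun I => ?_⟩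
  rw [C.matroid_setLoops_indep_iff, ← hv]
  have hYJ : ∀ p ∈ J, Y.col p = 0 := fun p hp => by
    ext i
    simp [ZMatrix.col, Y, hp]
  have hYv : Disjoint I J → (LinearIndepOn ℂ Y.col I ↔ LinearIndepOn ℂ v I) := by
    intro hdisj
    have hY : (fun p : I => Y.col p) = fun p : I => f (v p) := by
      ext p i
      simp [ZMatrix.col, Y, Set.disjoint_left.1 hdisj p.2]
    rw [LinearIndepOn, hY]
    exact ⟨fun h => LinearIndependent.of_comp f h,
      fun h => LinearIndepOn.of_map_eq (v := fun p => f (v p)) h g hfg⟩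
  refine ⟨fun h => ?_, fun h => (hYv h.2).2 h.1⟩
  have hdisj : Disjoint I J := Set.disjoint_left.2 fun p hpI hpJ => h.ne_zero hpI (hYJ p hpJ)
  exact ⟨(hYv hdisj).1 h, hdisj⟩

/-! ### Irreducible components of the combinatorial closure -/

/-- Given two realizations in open sets `U` and `V`, all but finitely many members of a curve
joining them are realizations lying in both sets. -/
theorem isPreirreducible_variety [Finite L] (C : PLConfig P L)
    (hC : C.incidenceGraph.LeafEliminable) (J : Set P) (d : ℕ) :
    IsPreirreducible ((C.matroid.setLoops J).variety d) := by
  refine IsPreirreducible.closure ?_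
  rintro U V hU hV ⟨X, hX, hXU⟩ ⟨Y, hY, hYV⟩
  have hXJ : ∀ p, X.col p = 0 ↔ p ∈ J := fun p => by
    rw [← not_iff_not, ← ne_eq, ← linearIndepOn_singleton_iff ℂ, hX,
      C.matroid_setLoops_indep_iff, Set.disjoint_singleton_left, and_iff_right]
    exact C.indepSet_of_ncard_le_two (by simp)
  obtain ⟨γ, h0, h1, hγ⟩ := C.exists_curve hC (J := J) (X := X)
    (fun I hI => ((C.matroid_setLoops_indep_iff J I).1 ((hX I).1 hI)).1)
    (fun p => (hXJ p).2) (fun p hp h => absurd ((hXJ p).1 h) hp) hY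
  obtain ⟨t, ht, htU, htV⟩ := (hγ.and ((ZMatrix.eventually_evalMat_mem γ hU (t₀ := 0)
    (by rwa [h0])).and (ZMatrix.eventually_evalMat_mem γ hV (t₀ := 1) (by rwa [h1])))).exists
  exact ⟨_, ht, htU, htV⟩

theorem exists_mem_variety [Finite L] (C : PLConfig P L) (hC : C.incidenceGraph.LeafEliminable)
    {d : ℕ} (hd : C.matroid.eRank ≤ (d : ℕ∞)) {X : ZMatrix d P}
    (hX : X ∈ C.matroid.combClosure d) :
    ∃ J ⊆ C.multiPoints, X ∈ (C.matroid.setLoops J).variety d := by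
  -- Exactly the zeros of `X` that cannot be moved away; its other zeros lie on at most two lines.
  let J : Set P := {p | p ∈ C.multiPoints ∧ X.col p = 0}
  obtain ⟨Y, hY⟩ := C.realizationSpace_nonempty hC J hd
  obtain ⟨γ, h0, -, hγ⟩ := C.exists_curve hC (J := J) (X := X)
    (fun I hI => Matroid.indep_of_mem_combClosure C.matroid_ground hX hI) (fun p hp => hp.2)
    (fun p hp h => not_le.1 fun h3 => hp ⟨h3, h⟩) hY
  refine ⟨J, fun p hp => hp.1, mem_closure_iff.2 fun U hU hXU => ?_⟩
  obtain ⟨t, ht, htU⟩ := (hγ.and (ZMatrix.eventually_evalMat_mem γ hU (t₀ := 0)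
    (by rwa [h0]))).exists
  exact ⟨_, htU, ht⟩

theorem exists_eq_variety_of_mem_irreducibleComponents [Finite L] (C : PLConfig P L)
    (hC : C.incidenceGraph.LeafEliminable) {d : ℕ} (hd : C.matroid.eRank ≤ (d : ℕ∞))
    {Z : Set (C.matroid.combClosure d)}
    (hZ : Z ∈ irreducibleComponents (C.matroid.combClosure d)) :
    ∃ J ⊆ C.multiPoints, Subtype.val '' Z = (C.matroid.setLoops J).variety d := by
  have hsub : ∀ J, (C.matroid.setLoops J).variety d ⊆ C.matroid.combClosure d := fun J =>
    Set.subset_biUnion_of_mem (u := fun N : Matroid P => N.variety d)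
      (C.matroid.depLE_setLoops J)
  let V : Set P → Set (C.matroid.combClosure d) := fun J =>
    Subtype.val ⁻¹' (C.matroid.setLoops J).variety d
  have hVimage : ∀ J, Subtype.val '' V J = (C.matroid.setLoops J).variety d := fun J => by
    rw [Subtype.image_preimage_coe, Set.inter_eq_right.2 (hsub J)]
  have hVirr : ∀ J, IsPreirreducible (V J) := fun J =>
    Topology.IsInducing.subtypeVal.isPreirreducible_of_image
      (by rw [hVimage]; exact C.isPreirreducible_variety hC J d)
  -- An irreducible set covered by finitely many closed sets lies in one of them; maximality of `Z`
  -- then gives equality.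
  obtain ⟨J, hJ, hZJ⟩ : ∃ J ⊆ C.multiPoints, Z ⊆ V J := by
    have hcover : Z ⊆ ⋃₀ (V '' 𝒫 C.multiPoints) := by
      intro X _
      obtain ⟨J, hJ, hXJ⟩ := C.exists_mem_variety hC hd X.2
      exact ⟨V J, ⟨J, hJ, rfl⟩, hXJ⟩
    have hfin : (V '' 𝒫 C.multiPoints).Finite := (Set.toFinite _).image V
    obtain ⟨W, hW, hZW⟩ := isIrreducible_iff_sUnion_isClosed.1 hZ.1 hfin.toFinset
      (by
        intro W hW
        obtain ⟨J, -, rfl⟩ := hfin.mem_toFinset.1 hW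
        exact isClosed_closure.preimage continuous_subtype_val)
      (by rwa [hfin.coe_toFinset])
    obtain ⟨J, hJ, rfl⟩ := hfin.mem_toFinset.1 hW
    exact ⟨J, hJ, hZW⟩
  refine ⟨J, hJ, ?_⟩
  rw [← hVimage J]
  congr 1
  exact hZJ.antisymm (hZ.2 ⟨hZ.1.1.mono hZJ, hVirr J⟩ hZJ)

end PLConfig

theorem theorem5p9 {P L : Type*} [Finite P] [Finite L] (C : PLConfig P L) (hC : C.IsForestLike)
    (d : ℕ) (hd : C.matroid.eRank ≤ (d : ℕ∞)) :
    (irreducibleComponents ↥(C.matroid.combClosure d)).encard ≤ 2 ^ C.multiPoints.ncard ∧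
    ∀ Z ∈ irreducibleComponents ↥(C.matroid.combClosure d),
      ∃ J ⊆ C.multiPoints, Subtype.val '' Z = (C.matroid.setLoops J).variety d := by
  have key : ∀ Z ∈ irreducibleComponents ↥(C.matroid.combClosure d),
      ∃ J ⊆ C.multiPoints, Subtype.val '' Z = (C.matroid.setLoops J).variety d := fun Z hZ =>
    C.exists_eq_variety_of_mem_irreducibleComponents hC.leafEliminable_incidenceGraph hd hZ
  refine ⟨?_, key⟩
  calc (irreducibleComponents ↥(C.matroid.combClosure d)).encard
      = (Set.image Subtype.val '' irreducibleComponents ↥(C.matroid.combClosure d)).encard :=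
        (Subtype.val_injective.image_injective.encard_image _).symm
    _ ≤ ((fun J => (C.matroid.setLoops J).variety d) '' 𝒫 C.multiPoints).encard := by
        refine Set.encard_le_encard ?_
        rintro _ ⟨Z, hZ, rfl⟩
        obtain ⟨J, hJ, h⟩ := key Z hZ
        exact ⟨J, hJ, h.symm⟩
    _ ≤ (𝒫 C.multiPoints).encard := Set.encard_image_le _ _
    _ = 2 ^ C.multiPoints.ncard := by
        rw [← Set.Finite.cast_ncard_eq (Set.toFinite _), Set.ncard_powerset]
        simp
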